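/- Let $m\ge 1$, let $\mathbb{R}^m$ carry the Euclidean norm, let $I$ be a nonempty compact Hausdorff space, and let $f_i:\mathbb{R}^m\to\mathbb{R}$ $(i\in I)$ be convex functions such that $i\mapsto f_i(x)$ is continuous on $I$ for each $x\in\mathbb{R}^m$. Put $$f(x):=\max_{i\in I}f_i(x),\qquad I_f(x):=\{i\in I: f_i(x)=f(x)\},\qquad S_f:=\{x\in\mathbb{R}^m: f(x)\le 0\},$$ let $\mathrm{bdry}(S_f)$ be the boundary of $S_f$, and let $f'(x,h):=\lim_{t\to0^+}\frac{f(x+th)-f(x)}{t}$. For $G:I\times\mathbb{R}^m\to\mathbb{R}$, $g_i:=G(i,\cdot)$, put $g(x):=\max_{i\in I}g_i(x)$, $I_g(x):=\{i\in I: g_i(x)=g(x)\}$, $S_G:=\{x: g_i(x)\le 0\ \forall i\in I\}$, and let $$\tau_{\min}(G):=\inf\{\tau>0:\ d(x,S_G)\le\tau\max\{g(x),0\}\ \text{ for all }x\in\mathbb{R}^m\}$$ be the global error bound modulus. For $\varphi:\mathbb{R}^m\to\mathbb{R}$ let $\mathrm{Lip}(\varphi):=\sup_{u\ne v}\frac{|\varphi(u)-\varphi(v)|}{\|u-v\|}\in[0,+\infty]$.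 By convention $\inf\emptyset=+\infty$ (in particular $d(x,\emptyset)=+\infty$). The following statements are equivalent: (i) There exists $\tau\in(0,+\infty)$ such that $$\inf\Big\{\Big|\min_{\|h\|=1}f'(\bar x,h)\Big|:\bar x\in\mathrm{bdry}(S_f)\Big\}>\tau,$$ and the following qualification condition (QC) holds with the same $\tau$: for every sequence $\{z_k\}\subseteq S_f\setminus\mathrm{bdry}(S_f)$ for which there is a sequence $\{x_k\}\subseteq\mathrm{bdry}(S_f)$ with $\lim_{k\to\infty}\frac{f(z_k)-f(x_k)}{\|z_k-x_k\|}=0$, one has $$\liminf_{k\to\infty}\Big|\min_{\|h\|=1}f'(z_k,h)\Big|>\tau .$$ (ii) There exist constants $c,\varepsilon>0$ such that $\tau_{\min}(G)\le c$ for every continuous $G:I\times\mathbb{R}^m\to\mathbb{R}$ with all $g_i=G(i,\cdot)$ convex that satisfies: there is $z\in\mathrm{bdry}(S_f)$ with $f_i(z)=g_i(z)$ for all $i\in I$; $\sup_{i\in I}\mathrm{Lip}(f_i-g_i)<\varepsilon$; and for every $x\in\mathbb{R}^m$, $$I_g(x)\subseteq I_f(x)\ \text{ whenever }\min_{\|h\|=1}f'(x,h)<0,\qquad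 I_f(x)\subseteq I_g(x)\ \text{ whenever }\min_{\|h\|=1}f'(x,h)>0 .$$ (iii) There exist constants $c,\varepsilon>0$ such that for all $\bar x\in\mathrm{bdry}(S_f)$ and all $u^*\in\mathbb{R}^m$ with $\|u^*\|\le 1$ one has $\tau_{\min}(G)\le c$, where $G(i,x):=f_i(x)+\varepsilon\langle u^*,x-\bar x\rangle$ for all $(i,x)\in I\times\mathbb{R}^m$. -/

import Mathlib

open Set Filter Topology
open scoped ENNReal

noncomputable section

namespace SemiInf

/-- The directional derivative `f'(x, h)`, the limit of `(f (x + t h) - f x) / t` as `t → 0⁺`.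
For a real-valued convex function this limit always exists, see `tendsto_dirDeriv`. -/
def dirDeriv {m : ℕ} (f : EuclideanSpace ℝ (Fin m) → ℝ) (x h : EuclideanSpace ℝ (Fin m)) : ℝ :=
  limUnder (𝓝[>] (0 : ℝ)) (fun t : ℝ => (f (x + t • h) - f x) / t)

/-- `min_{‖h‖ = 1} f'(x, h)`. For `m ≥ 1` and convex real-valued `f` the infimum is attained,
since `h ↦ f'(x, h)` is continuous and the unit sphere is nonempty and compact. -/
def minDirDeriv {m : ℕ} (f : EuclideanSpace ℝ (Fin m) → ℝ) (x : EuclideanSpace ℝ (Fin m)) : ℝ :=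
  sInf (dirDeriv f x '' Metric.sphere 0 1)

/-- The solution set `S_f = {x | f x ≤ 0}` of a single inequality. -/
def solSet {m : ℕ} (f : EuclideanSpace ℝ (Fin m) → ℝ) : Set (EuclideanSpace ℝ (Fin m)) :=
  {x | f x ≤ 0}

/-- `f(x) = max_i f_i(x)`. The maximum is attained when the index space is nonempty and compact
and `i ↦ f_i(x)` is continuous. -/
def maxFun {m : ℕ} {I : Type*} (F : I → EuclideanSpace ℝ (Fin m) → ℝ)
    (x : EuclideanSpace ℝ (Fin m)) : ℝ :=
  ⨆ i, F i x

/-- The active index set `I_f(x) = {i | f_i(x) = f(x)}`. -/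
def activeSet {m : ℕ} {I : Type*} (F : I → EuclideanSpace ℝ (Fin m) → ℝ)
    (x : EuclideanSpace ℝ (Fin m)) : Set I :=
  {i | F i x = maxFun F x}

/-- The solution set `S_F = {x | f_i(x) ≤ 0 for all i}` of the system. -/
def systemSolSet {m : ℕ} {I : Type*} (F : I → EuclideanSpace ℝ (Fin m) → ℝ) :
    Set (EuclideanSpace ℝ (Fin m)) :=
  {x | ∀ i, F i x ≤ 0}

/-- `τ` is a global error bound constant of the system: `d(x, S_F) ≤ τ [f(x)]₊` for all `x`,
with `d(x, ∅) = ∞`. -/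
def IsErrorBound {m : ℕ} {I : Type*} (F : I → EuclideanSpace ℝ (Fin m) → ℝ) (τ : ℝ) : Prop :=
  ∀ x, Metric.infEDist x (systemSolSet F) ≤ ENNReal.ofReal (τ * max (maxFun F x) 0)

/-- The global error bound modulus `τ_min(F)`, the infimum of all `τ > 0` that are global error
bound constants; it is `∞` if there are none. -/
def errorModulus {m : ℕ} {I : Type*} (F : I → EuclideanSpace ℝ (Fin m) → ℝ) : ℝ≥0∞ :=
  sInf (ENNReal.ofReal '' {τ : ℝ | 0 < τ ∧ IsErrorBound F τ})

/-- The Lipschitz constant `Lip(φ)`, with values in `[0, ∞]`. -/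
def lipConst {m : ℕ} (φ : EuclideanSpace ℝ (Fin m) → ℝ) : ℝ≥0∞ :=
  ⨆ (u : EuclideanSpace ℝ (Fin m)) (v : EuclideanSpace ℝ (Fin m)) (_ : u ≠ v),
    ENNReal.ofReal (‖φ u - φ v‖ / ‖u - v‖)

/-- The qualification condition (QC) for `f` with the constant `τ`. The lower limit is taken in
the extended reals. -/
def QC {m : ℕ} (f : EuclideanSpace ℝ (Fin m) → ℝ) (τ : ℝ) : Prop :=
  ∀ z : ℕ → EuclideanSpace ℝ (Fin m),
    (∀ k, z k ∈ solSet f \ frontier (solSet f)) →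
    (∃ x : ℕ → EuclideanSpace ℝ (Fin m), (∀ k, x k ∈ frontier (solSet f)) ∧
      Tendsto (fun k => (f (z k) - f (x k)) / ‖z k - x k‖) atTop (𝓝 0)) →
    (τ : EReal) < liminf (fun k => ((|minDirDeriv f (z k)| : ℝ) : EReal)) atTop

/-- The common linear perturbation `f_i + ε ⟨u, · - x₀⟩` of all the functions of the system. -/
def linPert {m : ℕ} {I : Type*} (F : I → EuclideanSpace ℝ (Fin m) → ℝ) (ε : ℝ)
    (u x₀ : EuclideanSpace ℝ (Fin m)) : I → EuclideanSpace ℝ (Fin m) → ℝ :=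
  fun i x => F i x + ε * inner ℝ u (x - x₀)

/-- For a convex function the limit in the definition of `dirDeriv` exists. -/
theorem tendsto_dirDeriv {m : ℕ} {f : EuclideanSpace ℝ (Fin m) → ℝ} (hf : ConvexOn ℝ univ f)
    (x h : EuclideanSpace ℝ (Fin m)) :
    Tendsto (fun t : ℝ => (f (x + t • h) - f x) / t) (𝓝[>] (0 : ℝ)) (𝓝 (dirDeriv f x h)) := by
  have hφ : ConvexOn ℝ univ (fun t : ℝ => f (x + t • h)) := by
    have h1 := hf.comp_affineMap (AffineMap.lineMap x (x + h))
    simp only [preimage_univ] at h1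
    refine h1.congr fun t _ => ?_
    simp [AffineMap.lineMap_apply, add_comm]
  have hd := hφ.differentiableWithinAt_Ioi_of_mem_interior (x := 0) (by simp)
  have h2 := hasDerivWithinAt_iff_tendsto_slope.1 hd.hasDerivWithinAt
  have h3 : Tendsto (fun t : ℝ => (f (x + t • h) - f x) / t) (𝓝[>] (0 : ℝ))
      (𝓝 (derivWithin (fun t : ℝ => f (x + t • h)) (Ioi 0) 0)) := by
    have e : Ioi (0 : ℝ) \ {0} = Ioi 0 := by simp
    rw [e] at h2
    refine h2.congr fun t => ?_
    simp [slope_def_field]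
  rw [dirDeriv, h3.limUnder_eq]
  exact h3

end SemiInf

end

namespace SemiInf

variable {m : ℕ} {I : Type*}

local notation "𝔼" => EuclideanSpace ℝ (Fin m)

/-! For convex `f`, `minDirDeriv f x` is the largest `a` with `f y ≥ f x + a * ‖y - x‖` for all `y`,
so the proof works with cones instead of derivatives.

(i) ⇒ (ii): let `z` be the common boundary point. If the slope at `z` is positive, `z` is a sharp
minimizer of `f` and stays one for `g`. Otherwise the slope is below `-τ` at `z`, and the boundary
bound with QC spreads this to every point of `S_f` where `g` can be positive; nearest points of
`S_f` carry descent outside `S_f`. The inclusion of active sets transfers descent to `g`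
(`exists_descent_of_activeSet_subset`), and descent wherever `g > 0` yields an error bound
(`exists_mem_solSet_mul_norm_sub_le`).

(ii) ⇒ (iii): a linear term common to all indices changes no active set.

(iii) ⇒ (i): a small slope gives a small subgradient (`exists_subgradient`). A linear tilt that
cancels it pushes the solution set behind a hyperplane while the tilted function stays small at some
point well in front, violating the error bound (`lt_maxFun_of_linPert`). -/

/-! ### Directional derivatives, slopes and subgradients of convex functions. -/

theorem convex_segment_le {f : 𝔼 → ℝ} (hf : ConvexOn ℝ univ f) (x y : 𝔼) {t : ℝ}
    (h0 : 0 ≤ t) (h1 : t ≤ 1) : f (x + t • (y - x)) ≤ (1 - t) * f x + t * f y := by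
  have h := hf.2 (mem_univ x) (mem_univ y) (sub_nonneg.2 h1) h0 (by ring)
  have e : (1 - t) • x + t • y = x + t • (y - x) := by module
  rwa [e] at h

theorem continuous_of_convexOn {f : 𝔼 → ℝ} (hf : ConvexOn ℝ univ f) : Continuous f :=
  hf.locallyLipschitz.continuous

theorem dirDeriv_le_div {f : 𝔼 → ℝ} (hf : ConvexOn ℝ univ f) (x h : 𝔼) {s : ℝ} (hs : 0 < s) :
    dirDeriv f x h ≤ (f (x + s • h) - f x) / s := by
  refine le_of_tendsto (tendsto_dirDeriv hf x h) ?_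
  filter_upwards [Ioo_mem_nhdsGT hs] with t ht
  have h1 := convex_segment_le hf x (x + s • h) (t := t / s) (div_nonneg ht.1.le hs.le)
    ((div_le_one hs).2 ht.2.le)
  have e : x + (t / s) • (x + s • h - x) = x + t • h := by
    rw [add_sub_cancel_left, smul_smul, div_mul_cancel₀ _ hs.ne']
  rw [e] at h1
  rw [div_le_div_iff₀ ht.1 hs]
  have h2 : s * (t / s) = t := by field_simp
  have h3 := mul_le_mul_of_nonneg_left h1 hs.le
  have h4 : s * ((1 - t / s) * f x + t / s * f (x + s • h))
      = s * f x - (s * (t / s)) * f x + (s * (t / s)) * f (x + s • h) := by ring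
  rw [h4, h2] at h3
  linarith

/-- By convexity, slopes increase along a line. The bound is continuous in `h`, so it keeps the
infimum over the sphere finite. -/
theorem sub_le_dirDeriv {f : 𝔼 → ℝ} (hf : ConvexOn ℝ univ f) (x h : 𝔼) :
    f x - f (x - h) ≤ dirDeriv f x h := by
  refine ge_of_tendsto (tendsto_dirDeriv hf x h) ?_
  filter_upwards [self_mem_nhdsWithin] with t (ht : 0 < t)
  have h1 := convex_segment_le hf (x + t • h) (x - h) (t := t / (1 + t)) (by positivity)
    ((div_le_one (by positivity)).2 (by linarith))
  have h0 : (1 + t) ≠ 0 := by positivity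
  have e : x + t • h + (t / (1 + t)) • (x - h - (x + t • h)) = x := by
    have e1 : x - h - (x + t • h) = -((1 + t) • h) := by module
    rw [e1, smul_neg, smul_smul, div_mul_cancel₀ _ h0]
    abel
  rw [e] at h1
  rw [le_div_iff₀ ht]
  have h3 := mul_le_mul_of_nonneg_left h1 (show 0 ≤ 1 + t by positivity)
  have h4 : (1 + t) * ((1 - t / (1 + t)) * f (x + t • h) + t / (1 + t) * f (x - h))
      = f (x + t • h) + t * f (x - h) := by field_simp; ring
  rw [h4] at h3
  linarith

theorem bddBelow_dirDeriv_sphere {f : 𝔼 → ℝ} (hf : ConvexOn ℝ univ f) (x : 𝔼) :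
    BddBelow (dirDeriv f x '' Metric.sphere 0 1) := by
  have hc : Continuous fun h : 𝔼 => f x - f (x - h) :=
    continuous_const.sub ((continuous_of_convexOn hf).comp (continuous_const.sub continuous_id))
  obtain ⟨C, hC⟩ := ((isCompact_sphere (0 : 𝔼) 1).image hc).bddBelow
  refine ⟨C, ?_⟩
  rintro _ ⟨h, hh, rfl⟩
  exact (hC (mem_image_of_mem _ hh)).trans (sub_le_dirDeriv hf x h)

/-- A purely order-theoretic description of `minDirDeriv` for convex functions. -/
theorem minDirDeriv_lt_iff (hm : 1 ≤ m) {f : 𝔼 → ℝ} (hf : ConvexOn ℝ univ f) (x : 𝔼) (a : ℝ) :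
    minDirDeriv f x < a ↔ ∃ y, y ≠ x ∧ f y < f x + a * ‖y - x‖ := by
  have : Nonempty (Fin m) := ⟨⟨0, hm⟩⟩
  have hne : (dirDeriv f x '' Metric.sphere 0 1).Nonempty :=
    (NormedSpace.sphere_nonempty.2 zero_le_one).image _
  rw [minDirDeriv, csInf_lt_iff (bddBelow_dirDeriv_sphere hf x) hne]
  constructor
  · rintro ⟨_, ⟨h, hh, rfl⟩, hlt⟩
    have hn : ‖h‖ = 1 := by simpa using hh
    obtain ⟨t, htlt, ht⟩ := (((tendsto_dirDeriv hf x h).eventually (gt_mem_nhds hlt)).and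
      self_mem_nhdsWithin).exists
    have ht : 0 < t := ht
    have hnt : ‖x + t • h - x‖ = t := by
      rw [add_sub_cancel_left, norm_smul, hn, mul_one, Real.norm_of_nonneg ht.le]
    refine ⟨x + t • h, fun e => ?_, ?_⟩
    · rw [e, sub_self, norm_zero] at hnt
      exact ht.ne hnt
    · rw [hnt]
      rw [div_lt_iff₀ ht] at htlt
      linarith
  · rintro ⟨y, hy, hlt⟩
    have hp : 0 < ‖y - x‖ := norm_pos_iff.2 (sub_ne_zero.2 hy)
    refine ⟨_, ⟨‖y - x‖⁻¹ • (y - x), ?_, rfl⟩, ?_⟩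
    · simp [norm_smul, hp.ne']
    · refine (dirDeriv_le_div hf x _ hp).trans_lt ?_
      rw [smul_smul, mul_inv_cancel₀ hp.ne', one_smul, add_sub_cancel, div_lt_iff₀ hp]
      linarith

theorem le_minDirDeriv_iff (hm : 1 ≤ m) {f : 𝔼 → ℝ} (hf : ConvexOn ℝ univ f) (x : 𝔼) (a : ℝ) :
    a ≤ minDirDeriv f x ↔ ∀ y, f x + a * ‖y - x‖ ≤ f y := by
  rw [← not_lt, minDirDeriv_lt_iff hm hf]
  push Not
  refine forall_congr' fun y => ⟨fun h => ?_, fun h _ => h⟩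
  rcases eq_or_ne y x with rfl | hy
  · simp
  · exact h hy

/-- A convex function minorized by a concave cone with apex on its graph has a subgradient
there whose norm is at most the slope of the cone. -/
theorem exists_subgradient {f : 𝔼 → ℝ} (hf : ConvexOn ℝ univ f) {x : 𝔼} {σ : ℝ} (hσ : 0 ≤ σ)
    (h : ∀ y, f x - σ * ‖y - x‖ ≤ f y) :
    ∃ s : 𝔼, ‖s‖ ≤ σ ∧ ∀ y, f x + inner ℝ s (y - x) ≤ f y := by
  have hfc := continuous_of_convexOn hf
  have hk : ConcaveOn ℝ univ fun y : 𝔼 => f x - σ * ‖y - x‖ := by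
    have h1 : ConvexOn ℝ univ fun y : 𝔼 => ‖y - x‖ := by
      have := (convexOn_univ_norm (E := 𝔼)).translate_left (-x)
      simpa [Function.comp_def, sub_eq_add_neg] using this
    exact (concaveOn_const (f x) convex_univ).sub (h1.smul hσ)
  -- Separate the strict epigraph of `f` from the strict hypograph of the cone.
  obtain ⟨φ, u, hA, hB⟩ := geometric_hahn_banach_open_open
    (s := {p : 𝔼 × ℝ | f p.1 < p.2}) (t := {p : 𝔼 × ℝ | p.2 < f x - σ * ‖p.1 - x‖})
    (by simpa using hf.convex_strict_epigraph)
    (isOpen_lt (hfc.comp continuous_fst) continuous_snd)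
    (by simpa using hk.convex_strict_hypograph)
    (isOpen_lt continuous_snd (by fun_prop))
    (by
      rw [Set.disjoint_left]
      rintro ⟨y, r⟩ h1 h2
      exact absurd (h y) (not_le.2 (lt_trans h1 h2)))
  set α : 𝔼 →L[ℝ] ℝ := φ.comp (ContinuousLinearMap.inl ℝ 𝔼 ℝ) with hα
  set β : ℝ := φ (0, 1) with hβ
  have hφ : ∀ y r, φ (y, r) = α y + r * β := by
    intro y r
    have e : ((y, r) : 𝔼 × ℝ) = (y, 0) + r • (0, 1) := by simp
    rw [e, map_add, map_smul]
    simp [hα, hβ]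
  have hβ0 : β < 0 := by
    have h1 := hA (x, f x + 1) (by simp)
    have h2 := hB (x, f x - 1) (by simp)
    rw [hφ] at h1 h2
    linarith
  have hA' : ∀ y, α y + f y * β ≤ u := by
    intro y
    have hc : Tendsto (fun r : ℝ => α y + r * β) (𝓝[>] (f y)) (𝓝 (α y + f y * β)) :=
      (Continuous.tendsto (by fun_prop) _).mono_left nhdsWithin_le_nhds
    refine le_of_tendsto hc ?_
    filter_upwards [self_mem_nhdsWithin] with r hr
    rw [← hφ]
    exact (hA (y, r) hr).le
  have hB' : ∀ y, u ≤ α y + (f x - σ * ‖y - x‖) * β := by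
    intro y
    have hc : Tendsto (fun r : ℝ => α y + r * β) (𝓝[<] (f x - σ * ‖y - x‖))
        (𝓝 (α y + (f x - σ * ‖y - x‖) * β)) :=
      (Continuous.tendsto (by fun_prop) _).mono_left nhdsWithin_le_nhds
    refine ge_of_tendsto hc ?_
    filter_upwards [self_mem_nhdsWithin] with r hr
    rw [← hφ]
    exact (hB (y, r) hr).le
  -- Both graphs pass through `(x, f x)`, so the separating hyperplane does too.
  have hu : u = α x + f x * β := le_antisymm (by simpa using hB' x) (hA' x)
  set γ : 𝔼 →L[ℝ] ℝ := (-β)⁻¹ • α with hγ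
  have hγα : ∀ y, α y = -β * γ y := fun y => by
    have : -β ≠ 0 := by linarith
    simp only [hγ, smul_apply, smul_eq_mul]
    rw [mul_inv_cancel_left₀ this]
  have hlow : ∀ v, -(σ * ‖v‖) ≤ γ v := by
    intro v
    have h1 := hB' (x + v)
    rw [hu, add_sub_cancel_left, map_add, hγα v] at h1
    by_contra! hcon
    nlinarith
  refine ⟨(InnerProductSpace.toDual ℝ 𝔼).symm γ, ?_, fun y => ?_⟩
  · rw [LinearIsometryEquiv.norm_map]
    refine γ.opNorm_le_bound hσ fun v => ?_
    rw [Real.norm_eq_abs, abs_le]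
    refine ⟨hlow v, ?_⟩
    have := hlow (-v)
    rw [norm_neg, map_neg] at this
    linarith
  · rw [InnerProductSpace.toDual_symm_apply]
    have h1 := hA' y
    have h2 : α y = α x + -β * γ (y - x) := by rw [← hγα, map_sub]; ring
    rw [hu, h2] at h1
    by_contra! hcon
    nlinarith

/-! ### Maxima over a compact index set. -/

section Max

variable [TopologicalSpace I] [CompactSpace I]

theorem bddAbove_range_apply {F : I → 𝔼 → ℝ}
    (hF : ∀ x, Continuous fun i => F i x) (x : 𝔼) :
    BddAbove (range fun i => F i x) :=
  (isCompact_range (hF x)).bddAbove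

theorem le_maxFun {F : I → 𝔼 → ℝ}
    (hF : ∀ x, Continuous fun i => F i x) (i : I) (x : 𝔼) : F i x ≤ maxFun F x :=
  le_ciSup (bddAbove_range_apply hF x) i

variable [Nonempty I]

theorem exists_eq_maxFun {F : I → 𝔼 → ℝ}
    (hF : ∀ x, Continuous fun i => F i x) (x : 𝔼) :
    ∃ i, F i x = maxFun F x := by
  obtain ⟨i, -, hi⟩ := isCompact_univ.exists_isMaxOn univ_nonempty (hF x).continuousOn
  exact ⟨i, le_antisymm (le_maxFun hF i x) (ciSup_le fun j => hi (mem_univ j))⟩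

theorem convexOn_maxFun {F : I → 𝔼 → ℝ}
    (hF : ∀ x, Continuous fun i => F i x)
    (hconv : ∀ i, ConvexOn ℝ univ (F i)) : ConvexOn ℝ univ (maxFun F) := by
  refine ⟨convex_univ, fun x _ y _ a b ha hb hab => ?_⟩
  refine ciSup_le fun i => ((hconv i).2 (mem_univ x) (mem_univ y) ha hb hab).trans ?_
  have h1 := mul_le_mul_of_nonneg_left (le_maxFun hF i x) ha
  have h2 := mul_le_mul_of_nonneg_left (le_maxFun hF i y) hb
  exact add_le_add h1 h2

theorem systemSolSet_eq {F : I → 𝔼 → ℝ}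
    (hF : ∀ x, Continuous fun i => F i x) :
    systemSolSet F = solSet (maxFun F) := by
  ext x
  exact ⟨fun h => ciSup_le h, fun h i => (le_maxFun hF i x).trans h⟩

/-- Near `x₀` all `F i` are bounded above by the maximum function, and at `x₀` they are bounded
below by compactness. Convexity turns this into a Lipschitz estimate at `x₀` uniform in `i`. -/
theorem continuous_uncurry_of_convexOn {F : I → 𝔼 → ℝ}
    (hF : ∀ x, Continuous fun i => F i x)
    (hconv : ∀ i, ConvexOn ℝ univ (F i)) : Continuous fun p : I × 𝔼 => F p.1 p.2 := by
  have hfc := continuous_of_convexOn (convexOn_maxFun hF hconv)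
  rw [continuous_iff_continuousAt]
  rintro ⟨i₀, x₀⟩
  obtain ⟨M, hM⟩ := ((isCompact_closedBall x₀ 1).image hfc).bddAbove
  obtain ⟨L, hL⟩ := (isCompact_range (hF x₀)).bddBelow
  have hM' : ∀ i y, ‖y - x₀‖ ≤ 1 → F i y - F i x₀ ≤ M - L := fun i y hy =>
    sub_le_sub ((le_maxFun hF i y).trans (hM (mem_image_of_mem _ (by
      rwa [mem_closedBall_iff_norm])))) (hL (mem_range_self i))
  have key : ∀ i y, ‖y - x₀‖ ≤ 1 → |F i y - F i x₀| ≤ (M - L) * ‖y - x₀‖ := by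
    intro i y hy
    rcases eq_or_ne y x₀ with rfl | hne
    · simp
    have hr : 0 < ‖y - x₀‖ := norm_pos_iff.2 (sub_ne_zero.2 hne)
    set r := ‖y - x₀‖ with hr_def
    have hn : ‖r⁻¹ • (y - x₀)‖ = 1 := by
      rw [norm_smul, ← hr_def, norm_inv, Real.norm_of_nonneg hr.le, inv_mul_cancel₀ hr.ne']
    have h1 := convex_segment_le (hconv i) x₀ (x₀ + r⁻¹ • (y - x₀)) hr.le hy
    have h2 := hM' i (x₀ + r⁻¹ • (y - x₀)) (by rw [add_sub_cancel_left, hn])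
    rw [add_sub_cancel_left, smul_smul, mul_inv_cancel₀ hr.ne', one_smul, add_sub_cancel] at h1
    have h3 := sub_le_dirDeriv (hconv i) x₀ (r⁻¹ • (y - x₀))
    have h4 := dirDeriv_le_div (hconv i) x₀ (r⁻¹ • (y - x₀)) hr
    rw [smul_smul, mul_inv_cancel₀ hr.ne', one_smul, add_sub_cancel] at h4
    have h5 := hM' i (x₀ - r⁻¹ • (y - x₀)) (by rw [sub_sub_cancel_left, norm_neg, hn])
    have h6 := h3.trans h4
    rw [le_div_iff₀ hr] at h6
    rw [abs_le]
    constructor <;> nlinarith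
  have hlim : Tendsto (fun p : I × 𝔼 => F p.1 p.2 - F p.1 x₀) (𝓝 (i₀, x₀)) (𝓝 0) := by
    have hn : Tendsto (fun p : I × 𝔼 => ‖p.2 - x₀‖) (𝓝 (i₀, x₀)) (𝓝 0) := by
      have : Continuous fun p : I × 𝔼 => ‖p.2 - x₀‖ := by fun_prop
      simpa using this.tendsto (i₀, x₀)
    refine squeeze_zero_norm' ?_ (by simpa using hn.const_mul (M - L))
    filter_upwards [hn.eventually (gt_mem_nhds one_pos)] with p hp
    exact key p.1 p.2 hp.le
  have hx : Tendsto (fun p : I × 𝔼 => F p.1 x₀) (𝓝 (i₀, x₀)) (𝓝 (F i₀ x₀)) :=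
    ((hF x₀).comp continuous_fst).tendsto (i₀, x₀)
  simpa [ContinuousAt] using hlim.add hx

end Max

/-! ### Nearest points, and error bounds from descent. -/

theorem eq_zero_of_mem_frontier {f : 𝔼 → ℝ} (hf : Continuous f) {x : 𝔼}
    (hx : x ∈ frontier (solSet f)) : f x = 0 :=
  frontier_le_subset_eq hf continuous_const hx

theorem isClosed_solSet {f : 𝔼 → ℝ} (hf : Continuous f) : IsClosed (solSet f) :=
  isClosed_le hf continuous_const

theorem exists_mem_solSet_norm_sub_lt {f : 𝔼 → ℝ} (hf : ConvexOn ℝ univ f) {x q : 𝔼}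
    (hx : 0 < f x) (hq : f q < 0) : ∃ y ∈ solSet f, ‖x - y‖ < ‖x - q‖ := by
  have hd : 0 < f x - f q := by linarith
  have ht : 0 < -f q / (f x - f q) := div_pos (by linarith) hd
  have ht1 : -f q / (f x - f q) ≤ 1 := (div_le_one hd).2 (by linarith)
  have hne : x ≠ q := by rintro rfl; linarith
  have hn : 0 < ‖x - q‖ := norm_pos_iff.2 (sub_ne_zero.2 hne)
  -- The zero of the chord of `f` over the segment from `q` to `x`.
  refine ⟨q + (-f q / (f x - f q)) • (x - q), ?_, ?_⟩
  · refine (convex_segment_le hf q x ht.le ht1).trans (le_of_eq ?_)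
    field_simp
    ring
  · have e : x - (q + (-f q / (f x - f q)) • (x - q))
        = (1 - -f q / (f x - f q)) • (x - q) := by module
    rw [e, norm_smul, Real.norm_of_nonneg (by linarith)]
    nlinarith

/-- If `p` is a nearest point to `x` in `S_f` at which `f` descends at rate more than `τ`,
then `f` grows at rate at least `τ` from `p` to `x`. -/
theorem mul_norm_sub_le_of_nearest {f : 𝔼 → ℝ} (hf : ConvexOn ℝ univ f) {x p y : 𝔼} {τ : ℝ}
    (hx : 0 < f x) (hp : f p = 0) (hmin : ∀ q ∈ solSet f, ‖x - p‖ ≤ ‖x - q‖)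
    (hyp : y ≠ p) (hy : f y < f p - τ * ‖y - p‖) : τ * ‖x - p‖ ≤ f x := by
  by_contra! hlt
  have hxp : x ≠ p := by rintro rfl; linarith
  set a := ‖y - p‖ with ha
  set b := ‖x - p‖ with hb
  have ha0 : 0 < a := norm_pos_iff.2 (sub_ne_zero.2 hyp)
  have hb0 : 0 < b := norm_pos_iff.2 (sub_ne_zero.2 hxp)
  have hab : 0 < a + b := by positivity
  -- The weight balances `f x < τ * b` against `f y < -τ * a`; since `‖y - x‖ ≤ a + b`, the point is
  -- also within `b` of `x`.
  have hneg : f (x + (b / (a + b)) • (y - x)) < 0 := by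
    refine (convex_segment_le hf x y (by positivity)
      ((div_le_one hab).2 (by linarith))).trans_lt ?_
    have e : (1 - b / (a + b)) * f x + b / (a + b) * f y = (a * f x + b * f y) / (a + b) := by
      field_simp
      ring
    rw [e]
    refine div_neg_of_neg_of_pos ?_ hab
    nlinarith [mul_lt_mul_of_pos_left hlt ha0, mul_lt_mul_of_pos_left hy hb0]
  obtain ⟨q, hq, hqlt⟩ := exists_mem_solSet_norm_sub_lt hf hx hneg
  have h1 := hmin q hq
  have h2 : ‖x - (x + (b / (a + b)) • (y - x))‖ ≤ b := by
    rw [sub_add_cancel_left, norm_neg, norm_smul, Real.norm_of_nonneg (by positivity)]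
    have h3 : ‖y - x‖ ≤ a + b := by
      have e : y - x = (y - p) - (x - p) := by abel
      rw [e]
      exact norm_sub_le _ _
    calc b / (a + b) * ‖y - x‖ ≤ b / (a + b) * (a + b) := by gcongr
      _ = b := div_mul_cancel₀ _ hab.ne'
  linarith

theorem exists_nearest_mem_frontier {f : 𝔼 → ℝ} (hf : Continuous f) (hne : (solSet f).Nonempty)
    {x : 𝔼} (hx : 0 < f x) :
    ∃ p ∈ frontier (solSet f), ∀ q ∈ solSet f, ‖x - p‖ ≤ ‖x - q‖ := by
  obtain ⟨p, hp, hpd⟩ := (isClosed_solSet hf).exists_infDist_eq_dist hne x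
  have hmin : ∀ q ∈ solSet f, ‖x - p‖ ≤ ‖x - q‖ := fun q hq => by
    rw [← dist_eq_norm, ← dist_eq_norm, ← hpd]
    exact Metric.infDist_le_dist_of_mem hq
  refine ⟨p, ⟨subset_closure hp, fun hint => ?_⟩, hmin⟩
  have hxp : 0 < ‖x - p‖ := norm_pos_iff.2 (sub_ne_zero.2 fun e => by
    rw [e] at hx
    exact absurd hp (not_le.2 hx))
  have hc : Tendsto (fun t : ℝ => p + t • (x - p)) (𝓝[>] 0) (𝓝 p) := by
    have : Continuous fun t : ℝ => p + t • (x - p) := by fun_prop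
    simpa using (this.tendsto 0).mono_left nhdsWithin_le_nhds
  obtain ⟨t, htS, ht⟩ := ((hc.eventually (mem_interior_iff_mem_nhds.1 hint)).and
    (Ioo_mem_nhdsGT one_pos)).exists
  have h1 := hmin _ htS
  have e : x - (p + t • (x - p)) = (1 - t) • (x - p) := by module
  rw [e, norm_smul, Real.norm_of_nonneg (by linarith [ht.2])] at h1
  nlinarith [ht.1]

/-- A function which descends at rate more than `η` wherever it is positive satisfies a global
error bound with constant `1 / η`. -/
theorem exists_mem_solSet_mul_norm_sub_le {g : 𝔼 → ℝ} (hg : ConvexOn ℝ univ g) {η : ℝ}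
    (hη : 0 < η) (h : ∀ x, 0 < g x → ∃ y, y ≠ x ∧ g y < g x - η * ‖y - x‖) (x : 𝔼) :
    ∃ w ∈ solSet g, η * ‖w - x‖ ≤ max (g x) 0 := by
  have hgc := continuous_of_convexOn hg
  have hlim : Tendsto (fun w => max (g w) 0 + η * ‖w - x‖) (cocompact 𝔼) atTop := by
    refine tendsto_atTop_mono (fun w => ?_)
      ((tendsto_norm_cocompact_atTop.comp
        (Homeomorph.subRight x).isClosedEmbedding.tendsto_cocompact).const_mul_atTop hη)
    simp
  -- Ekeland-type argument: a minimizer `w` of the penalized function must lie in `S_g`, as descent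
  -- at `w` would beat the penalty.
  obtain ⟨w, hw⟩ := (show Continuous fun w => max (g w) 0 + η * ‖w - x‖ by
    fun_prop).exists_forall_le hlim
  refine ⟨w, ?_, ?_⟩
  · by_contra hpos
    have hpos : 0 < g w := not_le.1 hpos
    obtain ⟨y, hy, hlt⟩ := h w hpos
    have hn : 0 < ‖y - w‖ := norm_pos_iff.2 (sub_ne_zero.2 hy)
    -- The step is short enough that truncation at `0` does not spoil the decrease.
    set t := min 1 (g w / (2 * (η * ‖y - w‖))) with ht
    have ht0 : 0 < t := by positivity
    have ht1 : t ≤ 1 := min_le_left _ _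
    have ht2 : t * (η * ‖y - w‖) ≤ g w / 2 := by
      calc t * (η * ‖y - w‖) ≤ g w / (2 * (η * ‖y - w‖)) * (η * ‖y - w‖) := by
            gcongr
            exact min_le_right _ _
        _ = g w / 2 := by field_simp
    have h1 := convex_segment_le hg w y ht0.le ht1
    have h2 := hw (w + t • (y - w))
    have h3 : ‖w + t • (y - w) - x‖ ≤ ‖w - x‖ + t * ‖y - w‖ := by
      have e : w + t • (y - w) - x = (w - x) + t • (y - w) := by abel
      rw [e]
      refine (norm_add_le _ _).trans_eq ?_
      rw [norm_smul, Real.norm_of_nonneg ht0.le]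
    have h4 := mul_le_mul_of_nonneg_left h3 hη.le
    have h5 := mul_lt_mul_of_pos_left hlt ht0
    have h6 : max (g (w + t • (y - w))) 0 < g w - t * (η * ‖y - w‖) :=
      max_lt (by linarith) (by linarith)
    rw [max_eq_left hpos.le] at h2
    linarith
  · have := hw x
    have h0 := le_max_right (g w) 0
    simp only [sub_self, norm_zero, mul_zero, add_zero] at this
    linarith

/-! ### Transfer of descent to a perturbed system. -/

section Systems

variable [TopologicalSpace I] [CompactSpace I] [Nonempty I]

/-- Descent passes from the supremum `f` to the supremum `g` of a perturbed system if
the perturbation does not create new active indices. -/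
theorem exists_descent_of_activeSet_subset {F G : I → 𝔼 → ℝ}
    (hF : ∀ x, Continuous fun i => F i x) (hG : ∀ x, Continuous fun i => G i x)
    (hGconv : ∀ i, ConvexOn ℝ univ (G i)) {a ε : ℝ} {x y : 𝔼}
    (hpert : ∀ i, G i y - G i x ≤ F i y - F i x + ε * ‖y - x‖)
    (hact : activeSet G x ⊆ activeSet F x) (hyx : y ≠ x)
    (hy : maxFun F y < maxFun F x + a * ‖y - x‖) :
    ∃ y, y ≠ x ∧ maxFun G y < maxFun G x + (a + ε) * ‖y - x‖ := by
  set b := (a + ε) * ‖y - x‖ with hb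
  -- The indices that do not descend fast enough. None is active at `x`, so by compactness they stay
  -- a gap `δ` below the maximum, and a short step cannot close it.
  set K : Set I := {i | b ≤ G i y - G i x} with hK
  have hKc : IsCompact K := (isClosed_le continuous_const ((hG y).sub (hG x))).isCompact
  have hKlt : ∀ i ∈ K, G i x < maxFun G x := by
    intro i hi
    refine lt_of_le_of_ne (le_maxFun hG i x) fun e => ?_
    have h1 : F i x = maxFun F x := hact e
    have h2 := le_maxFun hF i y
    have h3 : b ≤ G i y - G i x := hi
    have h4 := hpert i
    rw [hb] at h3
    linarith
  obtain ⟨δ, hδ, hKδ⟩ : ∃ δ > 0, ∀ i ∈ K, G i x ≤ maxFun G x - δ := by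
    rcases K.eq_empty_or_nonempty with hKe | hKne
    · exact ⟨1, one_pos, by simp [hKe]⟩
    · obtain ⟨j, hj, hjmax⟩ := hKc.exists_isMaxOn hKne (hG x).continuousOn
      exact ⟨maxFun G x - G j x, sub_pos.2 (hKlt j hj), fun i hi => by
        have : G i x ≤ G j x := hjmax hi
        linarith⟩
  have hlim : Tendsto (fun t : ℝ => t * (maxFun G y - maxFun G x + δ - b)) (𝓝[>] 0) (𝓝 0) := by
    have : Continuous fun t : ℝ => t * (maxFun G y - maxFun G x + δ - b) := by fun_prop
    simpa using (this.tendsto 0).mono_left nhdsWithin_le_nhds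
  obtain ⟨t, htδ, ht0, ht1⟩ := ((hlim.eventually (gt_mem_nhds hδ)).and
    (Ioo_mem_nhdsGT one_pos)).exists
  refine ⟨x + t • (y - x), fun e => ?_, ?_⟩
  · rw [add_eq_left, smul_eq_zero, sub_eq_zero] at e
    exact e.elim ht0.ne' hyx
  · rw [add_sub_cancel_left, norm_smul, Real.norm_of_nonneg ht0.le]
    have e : (a + ε) * (t * ‖y - x‖) = t * b := by rw [hb]; ring
    rw [e]
    obtain ⟨i, hi⟩ := exists_eq_maxFun hG (x + t • (y - x))
    rw [← hi]
    have h1 := convex_segment_le (hGconv i) x y ht0.le ht1.le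
    by_cases hiK : i ∈ K
    · have h2 := hKδ i hiK
      have h3 := le_maxFun hG i y
      nlinarith [mul_le_mul_of_nonneg_left h2 (sub_nonneg.2 ht1.le),
        mul_le_mul_of_nonneg_left h3 ht0.le]
    · have h2 : G i y - G i x < b := not_le.1 hiK
      have h3 := le_maxFun hG i x
      nlinarith [mul_lt_mul_of_pos_left h2 ht0]

theorem isErrorBound_of_exists {G : I → 𝔼 → ℝ} (hG : ∀ x, Continuous fun i => G i x) {η : ℝ}
    (hη : 0 < η) (h : ∀ x, ∃ w ∈ solSet (maxFun G), η * ‖w - x‖ ≤ max (maxFun G x) 0) :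
    IsErrorBound G η⁻¹ := by
  intro x
  obtain ⟨w, hw, hle⟩ := h x
  rw [systemSolSet_eq hG]
  refine (Metric.infEDist_le_edist_of_mem hw).trans ?_
  rw [edist_dist, dist_comm, dist_eq_norm]
  refine ENNReal.ofReal_le_ofReal ?_
  rwa [← div_eq_inv_mul, le_div_iff₀' hη]

end Systems

/-! ### Error bound modulus, Lipschitz constants and the uniform form of QC. -/

theorem errorModulus_le {G : I → 𝔼 → ℝ} {c : ℝ} (hc : 0 < c) (h : IsErrorBound G c) :
    errorModulus G ≤ ENNReal.ofReal c :=
  sInf_le ⟨c, ⟨hc, h⟩, rfl⟩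

theorem isErrorBound_of_errorModulus_le {G : I → 𝔼 → ℝ} {c c' : ℝ} (hc : 0 ≤ c) (hcc : c < c')
    (h : errorModulus G ≤ ENNReal.ofReal c) : IsErrorBound G c' := by
  have hlt : errorModulus G < ENNReal.ofReal c' :=
    h.trans_lt ((ENNReal.ofReal_lt_ofReal_iff (hc.trans_lt hcc)).2 hcc)
  obtain ⟨_, ⟨τ, ⟨hτ, hb⟩, rfl⟩, hτc⟩ := sInf_lt_iff.1 hlt
  refine fun x => (hb x).trans (ENNReal.ofReal_le_ofReal ?_)
  have := (ENNReal.ofReal_lt_ofReal_iff (hc.trans_lt hcc)).1 hτc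
  gcongr

theorem abs_sub_le_of_lipConst_lt {φ : 𝔼 → ℝ} {ε : ℝ} (hε : 0 ≤ ε)
    (h : lipConst φ ≤ ENNReal.ofReal ε) (u v : 𝔼) : |φ u - φ v| ≤ ε * ‖u - v‖ := by
  rcases eq_or_ne u v with rfl | huv
  · simp
  have h1 : ENNReal.ofReal (‖φ u - φ v‖ / ‖u - v‖) ≤ ENNReal.ofReal ε :=
    (le_iSup_of_le u (le_iSup_of_le v (le_iSup
      (fun _ : u ≠ v => ENNReal.ofReal (‖φ u - φ v‖ / ‖u - v‖)) huv))).trans h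
  rw [ENNReal.ofReal_le_ofReal_iff hε, div_le_iff₀ (norm_pos_iff.2 (sub_ne_zero.2 huv))] at h1
  exact h1

theorem lipConst_le {φ : 𝔼 → ℝ} {ε : ℝ} (h : ∀ u v, |φ u - φ v| ≤ ε * ‖u - v‖) :
    lipConst φ ≤ ENNReal.ofReal ε := by
  refine iSup_le fun u => iSup_le fun v => iSup_le fun huv => ENNReal.ofReal_le_ofReal ?_
  rw [div_le_iff₀ (norm_pos_iff.2 (sub_ne_zero.2 huv))]
  exact h u v

/-- An error bound controls how far the solution set can stay behind a hyperplane. -/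
theorem sub_le_of_isErrorBound {G : I → 𝔼 → ℝ} {c a : ℝ} (hc : 0 ≤ c) (hb : IsErrorBound G c)
    {h x₀ : 𝔼} (hh : ‖h‖ = 1) (hS : ∀ y ∈ systemSolSet G, inner ℝ h (y - x₀) ≤ a) (x : 𝔼) :
    inner ℝ h (x - x₀) - a ≤ c * max (maxFun G x) 0 := by
  have h1 : ENNReal.ofReal (inner ℝ h (x - x₀) - a) ≤ Metric.infEDist x (systemSolSet G) := by
    refine Metric.le_infEDist.2 fun y hy => ?_
    rw [edist_dist, dist_eq_norm]
    refine ENNReal.ofReal_le_ofReal ?_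
    have h2 := hS y hy
    have h3 := real_inner_le_norm h (x - y)
    rw [hh, one_mul] at h3
    have h4 : inner ℝ h (x - y) = inner ℝ h (x - x₀) - inner ℝ h (y - x₀) := by
      rw [← inner_sub_right, sub_sub_sub_cancel_right]
    linarith
  exact (ENNReal.ofReal_le_ofReal_iff (mul_nonneg hc (le_max_right _ _))).1 (h1.trans (hb x))

theorem maxFun_linPert [TopologicalSpace I] [CompactSpace I] [Nonempty I] {F : I → 𝔼 → ℝ}
    (hF : ∀ x, Continuous fun i => F i x) (ε : ℝ) (u x₀ x : 𝔼) :
    maxFun (linPert F ε u x₀) x = maxFun F x + ε * inner ℝ u (x - x₀) :=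
  (ciSup_add (bddAbove_range_apply hF x) _).symm

/-- The qualification condition as a uniform estimate: a small difference quotient to the
boundary forces `minDirDeriv` away from zero. -/
theorem QC.exists_uniform {f : 𝔼 → ℝ} {τ : ℝ} (h : QC f τ) :
    ∃ ε > 0, ∀ z ∈ solSet f \ frontier (solSet f), ∀ x ∈ frontier (solSet f),
      |f z - f x| ≤ ε * ‖z - x‖ → τ < |minDirDeriv f z| := by
  by_contra! hcon
  choose z hz x hx hle hτ using fun k : ℕ =>
    hcon (1 / ((k : ℝ) + 1)) Nat.one_div_pos_of_nat
  have hlim : Tendsto (fun k => (f (z k) - f (x k)) / ‖z k - x k‖) atTop (𝓝 0) := by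
    refine squeeze_zero_norm (fun k => ?_) tendsto_one_div_add_atTop_nhds_zero_nat
    have hne : z k ≠ x k := fun e => (hz k).2 (e ▸ hx k)
    rw [norm_div, norm_norm, div_le_iff₀ (norm_pos_iff.2 (sub_ne_zero.2 hne))]
    exact hle k
  refine absurd (h z hz ⟨x, hx, hlim⟩) (not_lt.2 ?_)
  refine liminf_le_of_frequently_le' (Frequently.of_forall fun k => ?_)
  exact_mod_cast hτ k

/-! ### Stability under perturbation, and its converse through linear tilts. -/

section Systems

variable [TopologicalSpace I] [CompactSpace I] [Nonempty I]

/-- The stability of the global error bound under admissible perturbations, in terms of the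
uniform form of the qualification condition. -/
theorem isErrorBound_of_perturbation (hm : 1 ≤ m) {F G : I → 𝔼 → ℝ}
    (hF : ∀ x, Continuous fun i => F i x) (hFconv : ∀ i, ConvexOn ℝ univ (F i))
    (hG : ∀ x, Continuous fun i => G i x) (hGconv : ∀ i, ConvexOn ℝ univ (G i)) {τ ε : ℝ}
    (hε : 0 < ε) (hετ : 4 * ε ≤ τ)
    (hbd : ∀ x ∈ frontier (solSet (maxFun F)), τ < |minDirDeriv (maxFun F) x|)
    (hqc : ∀ z ∈ solSet (maxFun F) \ frontier (solSet (maxFun F)),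
      ∀ x ∈ frontier (solSet (maxFun F)),
      |maxFun F z - maxFun F x| ≤ ε * ‖z - x‖ → τ < |minDirDeriv (maxFun F) z|)
    {z : 𝔼} (hz : z ∈ frontier (solSet (maxFun F))) (hFG : ∀ i, F i z = G i z)
    (hlip : ∀ i u v, |(F i u - G i u) - (F i v - G i v)| ≤ ε * ‖u - v‖)
    (hact : ∀ x, minDirDeriv (maxFun F) x < 0 → activeSet G x ⊆ activeSet F x) :
    IsErrorBound G (τ / 4)⁻¹ := by
  have hfconv := convexOn_maxFun hF hFconv
  have hgconv := convexOn_maxFun hG hGconv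
  have hfc := continuous_of_convexOn hfconv
  set f := maxFun F with hf
  have hfz : f z = 0 := eq_zero_of_mem_frontier hfc hz
  have hlow : ∀ i x, F i x - ε * ‖x - z‖ ≤ G i x := fun i x => by
    have := (abs_le.1 (hlip i x z)).2
    rw [hFG i] at this
    linarith
  have hhigh : ∀ i x, G i x ≤ F i x + ε * ‖x - z‖ := fun i x => by
    have := (abs_le.1 (hlip i x z)).1
    rw [hFG i] at this
    linarith
  have hgz : maxFun G z = 0 := by
    rw [← hfz, hf]
    exact iSup_congr fun i => (hFG i).symm
  refine isErrorBound_of_exists hG (by linarith) fun x => ?_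
  rcases lt_or_ge 0 (minDirDeriv f z) with hpos | hnonpos
  · -- `z` is a sharp minimizer of `f`
    have hτz := hbd z hz
    rw [abs_of_pos hpos] at hτz
    have h1 := (le_minDirDeriv_iff hm hfconv z τ).1 hτz.le x
    obtain ⟨i, hi⟩ := exists_eq_maxFun hF x
    have h2 := hlow i x
    have h3 := le_maxFun hG i x
    refine ⟨z, hgz.le, le_max_of_le_left ?_⟩
    rw [norm_sub_rev z x]
    have h4 : τ / 4 * ‖x - z‖ ≤ (τ - ε) * ‖x - z‖ := by
      gcongr
      linarith
    rw [hi, ← hf] at h2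
    linarith
  have hz_neg : minDirDeriv f z < -τ := by
    have := hbd z hz
    rw [abs_of_nonpos hnonpos] at this
    linarith
  -- By `hhigh`, these include all points of `S_f` where `g` is positive. Slope above `τ` is
  -- excluded there: it would force `f z > 0`, since `ε < τ`.
  have hin : ∀ x, f x ≤ 0 → -(ε * ‖x - z‖) ≤ f x → minDirDeriv f x < -τ := by
    intro x hx0 hxε
    by_cases hxz : x = z
    · rwa [hxz]
    have hn : 0 < ‖x - z‖ := norm_pos_iff.2 (sub_ne_zero.2 hxz)
    have habs : τ < |minDirDeriv f x| := by
      by_cases hfr : x ∈ frontier (solSet f)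
      · exact hbd x hfr
      · refine hqc x ⟨hx0, hfr⟩ z hz ?_
        rw [hfz, sub_zero, abs_of_nonpos hx0]
        linarith
    rcases lt_abs.1 habs with h | h
    · have h1 := (le_minDirDeriv_iff hm hfconv x τ).1 h.le z
      rw [hfz, norm_sub_rev] at h1
      nlinarith
    · linarith
  -- Descent past the nearest point `p` forces `f x ≥ τ * ‖x - p‖`; `τ / 2` leaves room for
  -- strictness.
  have hout : ∀ x, 0 < f x → minDirDeriv f x < -(τ / 2) := by
    intro x hx
    obtain ⟨p, hp, hmin⟩ := exists_nearest_mem_frontier hfc ⟨z, hfz.le⟩ hx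
    have hfp := eq_zero_of_mem_frontier hfc hp
    obtain ⟨y, hyp, hy⟩ := (minDirDeriv_lt_iff hm hfconv p (-τ)).1
      (hin p hfp.le (by rw [hfp, neg_nonpos]; positivity))
    have h1 := mul_norm_sub_le_of_nearest hfconv (τ := τ) hx hfp hmin hyp (by linarith)
    have hpx : p ≠ x := by
      rintro rfl
      exact hx.ne' hfp
    refine (minDirDeriv_lt_iff hm hfconv x _).2 ⟨p, hpx, ?_⟩
    have hn : 0 < ‖p - x‖ := norm_pos_iff.2 (sub_ne_zero.2 hpx)
    rw [norm_sub_rev] at h1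
    nlinarith
  refine exists_mem_solSet_mul_norm_sub_le hgconv (by linarith) (fun x hx => ?_) x
  have hslope : minDirDeriv f x < -(τ / 2) := by
    rcases lt_or_ge 0 (f x) with h | h
    · exact hout x h
    · obtain ⟨i, hi⟩ := exists_eq_maxFun hG x
      have h1 := hhigh i x
      have h2 := le_maxFun hF i x
      rw [← hf] at h2
      linarith [hin x h (by linarith)]
  obtain ⟨y, hyx, hy⟩ := (minDirDeriv_lt_iff hm hfconv x _).1 hslope
  obtain ⟨w, hwx, hw⟩ := exists_descent_of_activeSet_subset hF hG hGconv (ε := ε)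
    (fun i => by have := (abs_le.1 (hlip i y x)).1; linarith)
    (hact x (by linarith)) hyx hy
  refine ⟨w, hwx, hw.trans_le ?_⟩
  have : (-(τ / 2) + ε) * ‖w - x‖ ≤ -(τ / 4) * ‖w - x‖ := by
    gcongr
    linarith
  linarith

/-- A lower bound of `f` by an almost active, almost horizontal affine function, together with a
point at which `f` is small, is incompatible with error bounds stable under linear
perturbations. -/
theorem lt_maxFun_of_linPert {F : I → 𝔼 → ℝ} (hF : ∀ x, Continuous fun i => F i x)
    {c ε δ : ℝ} (hc : 0 < c) (hε : 0 < ε) (hδ : 0 < δ) (hδε : 2 * δ ≤ ε) (hδc : 8 * δ * c ≤ 1)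
    {x₀ z s : 𝔼} (hb : ∀ u : 𝔼, ‖u‖ ≤ 1 → IsErrorBound (linPert F ε u x₀) c)
    (hz : z ≠ x₀) (hs : ‖s‖ ≤ δ)
    (hlow : ∀ y, inner ℝ s (y - x₀) - δ / 2 * ‖z - x₀‖ ≤ maxFun F y) :
    δ * ‖z - x₀‖ < maxFun F z := by
  by_contra! hle
  set R := ‖z - x₀‖ with hR
  have hR0 : 0 < R := norm_pos_iff.2 (sub_ne_zero.2 hz)
  set h : 𝔼 := R⁻¹ • (z - x₀) with hh
  have hn : ‖h‖ = 1 := by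
    rw [hh, norm_smul, ← hR, norm_inv, Real.norm_of_nonneg hR0.le, inv_mul_cancel₀ hR0.ne']
  have hhz : inner ℝ h (z - x₀) = R := by
    rw [hh, real_inner_smul_left, real_inner_self_eq_norm_sq, ← hR]
    field_simp
  -- The tilt replaces the slope `s` by `δ • h`; `2 * δ ≤ ε` makes it admissible.
  set u : 𝔼 := ε⁻¹ • (δ • h - s) with hu
  have hu1 : ‖u‖ ≤ 1 := by
    rw [hu, norm_smul, norm_inv, Real.norm_of_nonneg hε.le, inv_mul_le_iff₀ hε]
    have := norm_sub_le (δ • h) s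
    rw [norm_smul, hn, Real.norm_of_nonneg hδ.le] at this
    linarith
  have hmax : ∀ y, maxFun (linPert F ε u x₀) y
      = maxFun F y + (δ * inner ℝ h (y - x₀) - inner ℝ s (y - x₀)) := fun y => by
    rw [maxFun_linPert hF, hu, real_inner_smul_left, inner_sub_left, real_inner_smul_left,
      mul_inv_cancel_left₀ hε.ne']
  have hcont : ∀ x, Continuous fun i => linPert F ε u x₀ i x := fun x =>
    (hF x).add continuous_const
  -- Tilted solutions satisfy `⟨h, y - x₀⟩ ≤ R / 2`, while `z` sits at height `R`. Hence `R / 2 ≤ c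
  -- * (3 * δ * R) ≤ 3 * R / 8`, a contradiction.
  have h1 := sub_le_of_isErrorBound hc.le (hb u hu1) hn (x₀ := x₀) (a := R / 2) (fun y hy => by
    rw [systemSolSet_eq hcont] at hy
    have h2 : maxFun (linPert F ε u x₀) y ≤ 0 := hy
    rw [hmax] at h2
    have h3 := hlow y
    have h4 : δ * inner ℝ h (y - x₀) ≤ δ * (R / 2) := by linarith
    exact le_of_mul_le_mul_left h4 hδ) z
  have h5 : max (maxFun (linPert F ε u x₀) z) 0 ≤ 3 * δ * R := by
    refine max_le ?_ (by positivity)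
    rw [hmax, hhz]
    have h6 := (abs_le.1 (abs_real_inner_le_norm s (z - x₀))).1
    have h7 : ‖s‖ * ‖z - x₀‖ ≤ δ * R := by gcongr
    linarith
  rw [hhz] at h1
  have h8 := mul_le_mul_of_nonneg_left h5 hc.le
  nlinarith

theorem le_abs_minDirDeriv_of_linPert (hm : 1 ≤ m) {F : I → 𝔼 → ℝ}
    (hF : ∀ x, Continuous fun i => F i x) (hconv : ∀ i, ConvexOn ℝ univ (F i))
    {c ε δ : ℝ} (hc : 0 < c) (hε : 0 < ε) (hδ : 0 < δ) (hδε : 2 * δ ≤ ε) (hδc : 8 * δ * c ≤ 1)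
    {x₀ : 𝔼} (hb : ∀ u : 𝔼, ‖u‖ ≤ 1 → IsErrorBound (linPert F ε u x₀) c)
    (hx₀ : maxFun F x₀ = 0) : δ ≤ |minDirDeriv (maxFun F) x₀| := by
  have hfconv := convexOn_maxFun hF hconv
  by_contra! hlt
  obtain ⟨h1, h2⟩ := abs_lt.1 hlt
  obtain ⟨z, hz, hzlt⟩ := (minDirDeriv_lt_iff hm hfconv x₀ δ).1 h2
  obtain ⟨s, hs, hsub⟩ := exists_subgradient hfconv (x := x₀) hδ.le fun y => by
    have := (le_minDirDeriv_iff hm hfconv x₀ (-δ)).1 h1.le y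
    linarith
  rw [hx₀] at hzlt
  refine (lt_maxFun_of_linPert hF hc hε hδ hδε hδc hb hz hs fun y => ?_).not_ge (by linarith)
  have h3 := hsub y
  have h4 : 0 ≤ δ / 2 * ‖z - x₀‖ := by positivity
  linarith

/-- Moving the base of a subgradient from `z` to `x₀` costs `δ / 4 * ‖z - x₀‖`, and `f z` costs as
much again: exactly the slack `δ / 2` of `lt_maxFun_of_linPert`. -/
theorem le_abs_minDirDeriv_of_linPert_of_neg_le (hm : 1 ≤ m) {F : I → 𝔼 → ℝ}
    (hF : ∀ x, Continuous fun i => F i x) (hconv : ∀ i, ConvexOn ℝ univ (F i))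
    {c ε δ : ℝ} (hc : 0 < c) (hε : 0 < ε) (hδ : 0 < δ) (hδε : 2 * δ ≤ ε) (hδc : 8 * δ * c ≤ 1)
    {x₀ z : 𝔼} (hb : ∀ u : 𝔼, ‖u‖ ≤ 1 → IsErrorBound (linPert F ε u x₀) c)
    (hz : z ≠ x₀) (hz0 : maxFun F z ≤ 0) (hzδ : -(δ / 4 * ‖z - x₀‖) ≤ maxFun F z) :
    δ / 4 ≤ |minDirDeriv (maxFun F) z| := by
  have hfconv := convexOn_maxFun hF hconv
  by_contra! hlt
  obtain ⟨s, hs, hsub⟩ := exists_subgradient hfconv (x := z) (σ := δ / 4) (by positivity) fun y => by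
    have := (le_minDirDeriv_iff hm hfconv z (-(δ / 4))).1 (abs_lt.1 hlt).1.le y
    linarith
  refine (lt_maxFun_of_linPert hF hc hε hδ hδε hδc hb hz (s := s) (by linarith)
    fun y => ?_).not_ge (hz0.trans (by positivity))
  have h3 := hsub y
  have h4 : inner ℝ s (y - z) = inner ℝ s (y - x₀) - inner ℝ s (z - x₀) := by
    rw [← inner_sub_right, sub_sub_sub_cancel_right]
  have h5 := real_inner_le_norm s (z - x₀)
  have h6 : ‖s‖ * ‖z - x₀‖ ≤ δ / 4 * ‖z - x₀‖ := by gcongr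
  linarith

end Systems

end SemiInf

/-! ### The equivalence. -/

open SemiInf in
theorem theorem4p2 {m : ℕ} (hm : 1 ≤ m)
    {I : Type*} [TopologicalSpace I] [CompactSpace I] [T2Space I] [Nonempty I]
    (F : I → EuclideanSpace ℝ (Fin m) → ℝ)
    (hconv : ∀ i, ConvexOn ℝ Set.univ (F i))
    (hcont : ∀ x, Continuous (fun i => F i x)) :
    List.TFAE [
      ∃ τ : ℝ, 0 < τ ∧
        (τ : EReal) < (⨅ x ∈ frontier (SemiInf.solSet (SemiInf.maxFun F)),
          ((|SemiInf.minDirDeriv (SemiInf.maxFun F) x| : ℝ) : EReal)) ∧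
        SemiInf.QC (SemiInf.maxFun F) τ,
      ∃ c ε : ℝ, 0 < c ∧ 0 < ε ∧
        ∀ G : I → EuclideanSpace ℝ (Fin m) → ℝ,
          Continuous (fun p : I × EuclideanSpace ℝ (Fin m) => G p.1 p.2) →
          (∀ i, ConvexOn ℝ Set.univ (G i)) →
          {z ∈ frontier (SemiInf.solSet (SemiInf.maxFun F)) | ∀ i, F i z = G i z}.Nonempty →
          (⨆ i, SemiInf.lipConst (fun x => F i x - G i x)) < ENNReal.ofReal ε →
          (∀ x, SemiInf.minDirDeriv (SemiInf.maxFun F) x < 0 →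
            SemiInf.activeSet G x ⊆ SemiInf.activeSet F x) →
          (∀ x, 0 < SemiInf.minDirDeriv (SemiInf.maxFun F) x →
            SemiInf.activeSet F x ⊆ SemiInf.activeSet G x) →
          SemiInf.errorModulus G ≤ ENNReal.ofReal c,
      ∃ c ε : ℝ, 0 < c ∧ 0 < ε ∧
        ∀ x₀ ∈ frontier (SemiInf.solSet (SemiInf.maxFun F)),
          ∀ u : EuclideanSpace ℝ (Fin m), ‖u‖ ≤ 1 →
            SemiInf.errorModulus (SemiInf.linPert F ε u x₀) ≤ ENNReal.ofReal c] := by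
  have hfc := continuous_of_convexOn (convexOn_maxFun hcont hconv)
  tfae_have 1 → 2 := by
    rintro ⟨τ, hτ, hinf, hqc⟩
    obtain ⟨ε₀, hε₀, hunif⟩ := hqc.exists_uniform
    have hε : 0 < min ε₀ (τ / 4) := by positivity
    refine ⟨(τ / 4)⁻¹, min ε₀ (τ / 4), by positivity, hε,
      fun G hG hGconv ⟨z, hz, hFG⟩ hlip hact _ => errorModulus_le (by positivity) ?_⟩
    refine isErrorBound_of_perturbation hm hcont hconv
      (fun x => hG.comp (continuous_id.prodMk continuous_const)) hGconv hε
      (by linarith [min_le_right ε₀ (τ / 4)]) (fun x hx => ?_) (fun w hw x hx hle => ?_) hz hFG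
      (fun i u v => ?_) hact
    · exact EReal.coe_lt_coe_iff.1 (hinf.trans_le (iInf₂_le x hx))
    · refine hunif w hw x hx (hle.trans ?_)
      gcongr
      exact min_le_left _ _
    · exact abs_sub_le_of_lipConst_lt hε.le ((le_iSup (fun i =>
        lipConst fun x => F i x - G i x) i).trans hlip.le) u v
  tfae_have 2 → 3 := by
    rintro ⟨c, ε, hc, hε, h⟩
    -- Halving gives the strict Lipschitz bound required in (ii).
    refine ⟨c, ε / 2, hc, by positivity, fun x₀ hx₀ u hu => ?_⟩
    have hact : ∀ x, activeSet (linPert F (ε / 2) u x₀) x = activeSet F x := fun x => by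
      ext i
      simp only [activeSet, mem_ofPred_eq, maxFun_linPert hcont]
      simp [linPert]
    refine h _ ?_ (fun i => ?_) ⟨x₀, hx₀, fun i => by simp [linPert]⟩ ?_
      (fun x _ => (hact x).subset) (fun x _ => (hact x).symm.subset)
    · exact (continuous_uncurry_of_convexOn hcont hconv).add (by fun_prop)
    · refine (hconv i).add ⟨convex_univ, fun x _ y _ a b _ _ hab => le_of_eq ?_⟩
      have e : a • x + b • y - x₀ = a • (x - x₀) + b • (y - x₀) := by
        rw [smul_sub, smul_sub, sub_add_sub_comm, ← add_smul, hab, one_smul]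
      simp only [smul_eq_mul]
      rw [e, inner_add_right, real_inner_smul_right, real_inner_smul_right]
      ring
    · refine (iSup_le fun i => lipConst_le (ε := ε / 2) fun v w => ?_).trans_lt
        ((ENNReal.ofReal_lt_ofReal_iff hε).2 (half_lt_self hε))
      have e : F i v - linPert F (ε / 2) u x₀ i v - (F i w - linPert F (ε / 2) u x₀ i w)
          = -(ε / 2 * inner ℝ u (v - w)) := by
        have : inner ℝ u (v - w) = inner ℝ u (v - x₀) - inner ℝ u (w - x₀) := by
          rw [← inner_sub_right, sub_sub_sub_cancel_right]
        rw [this, linPert, linPert]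
        ring
      rw [e, abs_neg, abs_mul, abs_of_pos (half_pos hε)]
      gcongr
      refine (abs_real_inner_le_norm u (v - w)).trans ?_
      exact mul_le_of_le_one_left (norm_nonneg _) hu
  tfae_have 3 → 1 := by
    rintro ⟨c, ε, hc, hε, h⟩
    -- The modulus is an infimum, so a constant above `c` is taken.
    have hb : ∀ x₀ ∈ frontier (solSet (maxFun F)), ∀ u : EuclideanSpace ℝ (Fin m), ‖u‖ ≤ 1 →
        IsErrorBound (linPert F ε u x₀) (c + 1) := fun x₀ hx₀ u hu =>
      isErrorBound_of_errorModulus_le hc.le (lt_add_one c) (h x₀ hx₀ u hu)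
    set δ := min (ε / 2) (1 / (8 * (c + 1))) with hδ_def
    have hc1 : 0 < c + 1 := by positivity
    have hδ : 0 < δ := by positivity
    have hδε : 2 * δ ≤ ε := by linarith [min_le_left (ε / 2) (1 / (8 * (c + 1)))]
    have hδc : 8 * δ * (c + 1) ≤ 1 := by
      have := min_le_right (ε / 2) (1 / (8 * (c + 1)))
      rw [← hδ_def, le_div_iff₀ (by positivity)] at this
      linarith
    -- Strictly below both lower bounds: `δ` on the boundary, `δ / 4` in QC.
    refine ⟨δ / 8, by positivity, ?_, ?_⟩
    · refine lt_of_lt_of_le (b := (δ : EReal)) (by exact_mod_cast (by linarith : δ / 8 < δ)) ?_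
      refine le_iInf₂ fun x hx => ?_
      exact_mod_cast le_abs_minDirDeriv_of_linPert hm hcont hconv hc1 hε hδ hδε hδc (hb x hx)
        (eq_zero_of_mem_frontier hfc hx)
    · rintro z hz ⟨x, hx, hlim⟩
      refine lt_of_lt_of_le (b := ((δ / 4 : ℝ) : EReal))
        (by exact_mod_cast (by linarith : δ / 8 < δ / 4)) ?_
      refine le_liminf_of_le (by isBoundedDefault) ?_
      filter_upwards [hlim.eventually (lt_mem_nhds (show -(δ / 4) < 0 by linarith))] with k hk
      have hne : z k ≠ x k := fun e => (hz k).2 (e ▸ hx k)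
      rw [eq_zero_of_mem_frontier hfc (hx k), sub_zero,
        lt_div_iff₀ (norm_pos_iff.2 (sub_ne_zero.2 hne))] at hk
      exact_mod_cast le_abs_minDirDeriv_of_linPert_of_neg_le hm hcont hconv hc1 hε hδ hδε hδc
        (hb (x k) (hx k)) hne (hz k).1 (by linarith)
  tfae_finish
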